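/- Let $\mathbb B$ be a set of basic actions. A SAND attack tree is a term built from elements $b\in\mathbb B$ with the unranked operators $\mathrm{OR}$, $\mathrm{AND}$, $\mathrm{SAND}$, each applied to a finite sequence of at least one argument. Trees are considered modulo commutativity of $\mathrm{OR}$ and $\mathrm{AND}$, that is, modulo the congruence generated by permuting the arguments of an $\mathrm{OR}$ or of an $\mathrm{AND}$. Let $R$ be the term rewriting system with the following rules, where $\overline X = X_1,\dots,X_k$ and $\overline Z = Z_1,\dots,Z_m$ ($k,m\ge 0$) are possibly empty sequences and $\overline Y = Y_1,\dots,Y_\ell$ ($\ell\ge 1$) is a nonempty sequence: \[ \begin{array}{lrcl} (E_3) & \mathrm{OR}(\overline X,\mathrm{OR}(\overline Y)) &\to& \mathrm{OR}(\overline X,\overline Y)\\ (E_4) & \mathrm{AND}(\overline X,\mathrm{AND}(\overline Y)) &\to& \mathrm{AND}(\overline X,\overline Y)\\ (E_{4'}) & \mathrm{SAND}(\overline X,\mathrm{SAND}(\overline Y),\overline Z) &\to& \mathrm{SAND}(\overline X,\overline Y,\overline Z)\\ (E_5) & \mathrm{OR}(A) &\to& A\\ (E_6) & \mathrm{AND}(A)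 &\to& A\\ (E_{6'}) & \mathrm{SAND}(A) &\to& A\\ (E_{10}) & \mathrm{AND}(\overline X,\mathrm{OR}(\overline Y)) &\to& \mathrm{OR}(\mathrm{AND}(\overline X,Y_1),\dots,\mathrm{AND}(\overline X,Y_\ell))\\ (E_{10'}) & \mathrm{SAND}(\overline X,\mathrm{OR}(\overline Y),\overline Z) &\to& \mathrm{OR}(\mathrm{SAND}(\overline X,Y_1,\overline Z),\dots,\mathrm{SAND}(\overline X,Y_\ell,\overline Z))\\ (E_{11}) & \mathrm{OR}(A,A,\overline X) &\to& \mathrm{OR}(A,\overline X) \end{array} \] A class of trees modulo commutativity rewrites in one step to another class if some representative of the first becomes some representative of the second by applying an instance of one rule to one subterm. Then: 1. $R$ (modulo commutativity of $\mathrm{OR}$ and $\mathrm{AND}$) is strongly terminating: there is no infinite reduction sequence. 2. $R$ (modulo commutativity of $\mathrm{OR}$ and $\mathrm{AND}$) is confluent: any two reductions starting from the same class can be continued to a common class. 3. The normal forms of $R$ are exactly the trees generated by $N$ in the following grammar, where $k\ge 2$ and $b\in\mathbb B$: \[ \begin{array}{rcl} N &::=& S \mid \mathrm{OR}(S_1,\dots,S_k)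 \quad\text{with } S_i\ne S_j \text{ modulo commutativity whenever } i\ne j,\\ S &::=& C \mid D,\\ C &::=& b \mid \mathrm{AND}(D_1,\dots,D_k),\\ D &::=& b \mid \mathrm{SAND}(C_1,\dots,C_k). \end{array} \] 4. Every tree has exactly one normal form, up to commutativity of $\mathrm{OR}$ and $\mathrm{AND}$. -/

import Mathlib

universe u

/-- Terms over the basic actions `B` and the unranked operators `OR`, `AND`, `SAND`.
Operators without arguments are excluded below by `SandTerm.IsTree`. -/
inductive SandTerm (B : Type u) : Type u
  | basic (b : B) : SandTerm B
  | OR (ts : List (SandTerm B)) : SandTerm B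
  | AND (ts : List (SandTerm B)) : SandTerm B
  | SAND (ts : List (SandTerm B)) : SandTerm B

namespace SandTerm

variable {B : Type u}

/-- Every operator occurring in the term has at least one argument. -/
inductive IsTree : SandTerm B → Prop
  | basic (b : B) : IsTree (basic b)
  | or (ts : List (SandTerm B)) : ts ≠ [] → (∀ t ∈ ts, IsTree t) → IsTree (OR ts)
  | and (ts : List (SandTerm B)) : ts ≠ [] → (∀ t ∈ ts, IsTree t) → IsTree (AND ts)
  | sand (ts : List (SandTerm B)) : ts ≠ [] → (∀ t ∈ ts, IsTree t) → IsTree (SAND ts)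

/-- The closure of a relation on terms under contexts: one subterm is replaced. -/
inductive InContext (r : SandTerm B → SandTerm B → Prop) : SandTerm B → SandTerm B → Prop
  | root {s t : SandTerm B} : r s t → InContext r s t
  | or (X Z : List (SandTerm B)) {s t : SandTerm B} :
      InContext r s t → InContext r (OR (X ++ s :: Z)) (OR (X ++ t :: Z))
  | and (X Z : List (SandTerm B)) {s t : SandTerm B} :
      InContext r s t → InContext r (AND (X ++ s :: Z)) (AND (X ++ t :: Z))
  | sand (X Z : List (SandTerm B)) {s t : SandTerm B} :
      InContext r s t → InContext r (SAND (X ++ s :: Z)) (SAND (X ++ t :: Z))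

/-- Instances of the commutativity axioms `E₁` and `E₂` of `OR` and `AND`. -/
inductive CommAxiom : SandTerm B → SandTerm B → Prop
  | E1 {Y Y' : List (SandTerm B)} : Y.Perm Y' → CommAxiom (OR Y) (OR Y')
  | E2 {Y Y' : List (SandTerm B)} : Y.Perm Y' → CommAxiom (AND Y) (AND Y')

/-- Equality of terms modulo commutativity of `OR` and `AND`: the congruence generated by
`E₁` and `E₂`. -/
def CommEq : SandTerm B → SandTerm B → Prop :=
  Relation.EqvGen (InContext CommAxiom)

/-- Instances of the rewrite rules: the axioms oriented from left to right. Sequences `X`, `Z`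
may be empty, sequences `Y` may not. -/
inductive Rule : SandTerm B → SandTerm B → Prop
  | E3 (X Y : List (SandTerm B)) : Y ≠ [] → Rule (OR (X ++ [OR Y])) (OR (X ++ Y))
  | E4 (X Y : List (SandTerm B)) : Y ≠ [] → Rule (AND (X ++ [AND Y])) (AND (X ++ Y))
  | E4' (X Y Z : List (SandTerm B)) : Y ≠ [] →
      Rule (SAND (X ++ [SAND Y] ++ Z)) (SAND (X ++ Y ++ Z))
  | E5 (A : SandTerm B) : Rule (OR [A]) A
  | E6 (A : SandTerm B) : Rule (AND [A]) A
  | E6' (A : SandTerm B) : Rule (SAND [A]) A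
  | E10 (X Y : List (SandTerm B)) : Y ≠ [] →
      Rule (AND (X ++ [OR Y])) (OR (Y.map fun y => AND (X ++ [y])))
  | E10' (X Y Z : List (SandTerm B)) : Y ≠ [] →
      Rule (SAND (X ++ [OR Y] ++ Z)) (OR (Y.map fun y => SAND (X ++ [y] ++ Z)))
  | E11 (A : SandTerm B) (X : List (SandTerm B)) : Rule (OR (A :: A :: X)) (OR (A :: X))

/-- One rewrite step (of a subterm, at any position), without commutativity. -/
def Step : SandTerm B → SandTerm B → Prop :=
  InContext Rule

/- The grammar
  `N_∧ ::= b | AND(N_→, …, N_→)`  and  `N_→ ::= b | SAND(N_∧, …, N_∧)`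
with at least two arguments in each case. -/
mutual

/-- Terms generated by `N_∧ ::= b | AND(N_→, …, N_→)`. -/
inductive IsAndNF : SandTerm B → Prop
  | basic (b : B) : IsAndNF (basic b)
  | and (ts : List (SandTerm B)) : 2 ≤ ts.length → (∀ t ∈ ts, IsSandNF t) → IsAndNF (AND ts)

/-- Terms generated by `N_→ ::= b | SAND(N_∧, …, N_∧)`. -/
inductive IsSandNF : SandTerm B → Prop
  | basic (b : B) : IsSandNF (basic b)
  | sand (ts : List (SandTerm B)) : 2 ≤ ts.length → (∀ t ∈ ts, IsAndNF t) → IsSandNF (SAND ts)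

end

/-- Terms in which `AND` and `SAND` alternate: `A ::= N_∧ | N_→`. -/
inductive IsAltNF : SandTerm B → Prop
  | and {t : SandTerm B} : IsAndNF t → IsAltNF t
  | sand {t : SandTerm B} : IsSandNF t → IsAltNF t

/-- Terms generated by `N ::= A | OR(A₁, …, Aₖ)` with `k ≥ 2` and the `Aᵢ` pairwise distinct
(as terms modulo commutativity). -/
inductive IsGrammarNF : SandTerm B → Prop
  | single {t : SandTerm B} : IsAltNF t → IsGrammarNF t
  | or (ts : List (SandTerm B)) : 2 ≤ ts.length → (∀ t ∈ ts, IsAltNF t) →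
      ts.Pairwise (fun s t => ¬ CommEq s t) → IsGrammarNF (OR ts)

end SandTerm

/-- `SAND` attack trees over `B`. -/
def SandTree (B : Type u) : Type u :=
  {t : SandTerm B // t.IsTree}

/-- Equality of `SAND` attack trees modulo commutativity of `OR` and `AND`. -/
def SandTree.commSetoid (B : Type u) : Setoid (SandTree B) :=
  (Relation.EqvGen.setoid (SandTerm.InContext SandTerm.CommAxiom)).comap Subtype.val

/-- `SAND` attack trees modulo commutativity of `OR` and `AND`. -/
def SandTreeModComm (B : Type u) : Type u :=
  Quotient (SandTree.commSetoid B)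

/-- The class of a `SAND` attack tree modulo commutativity. -/
def SandTree.cls {B : Type u} (t : SandTree B) : SandTreeModComm B :=
  Quotient.mk (SandTree.commSetoid B) t

/-- The rewrite relation modulo commutativity: a class rewrites to another one if some
representative of the first rewrites in one step to some representative of the second. -/
def SandTreeModComm.Rewrites {B : Type u} (p q : SandTreeModComm B) : Prop :=
  ∃ s t : SandTree B, s.cls = p ∧ t.cls = q ∧ SandTerm.Step s.val t.val

/-- Strong termination of an abstract rewrite relation: no infinite reduction sequence. -/
def StronglyTerminating {α : Type u} (r : α → α → Prop) : Prop :=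
  ¬ ∃ f : ℕ → α, ∀ n, r (f n) (f (n + 1))

/-- Confluence of an abstract rewrite relation: diverging reductions can be joined. -/
def Confluent {α : Type u} (r : α → α → Prop) : Prop :=
  ∀ a b c : α, Relation.ReflTransGen r a b → Relation.ReflTransGen r a c →
    ∃ d : α, Relation.ReflTransGen r b d ∧ Relation.ReflTransGen r c d

/-- Normal forms of an abstract rewrite relation: elements that cannot be rewritten. -/
def IsNormalForm {α : Type u} (r : α → α → Prop) (a : α) : Prop :=
  ∀ b : α, ¬ r a b

namespace SandTerm

variable {B : Type u}

-- Termination comes from a polynomial weight that commutativity leaves unchanged: `OR` is one plus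
-- the sum of its arguments, `AND` and `SAND` are twice the product. Every rule lowers it, and each
-- operator is strictly monotone in each argument because weights are positive, so every step lowers
-- it.
--
-- Confluence needs no critical pairs: it follows from a complete invariant. Choosing one disjunct
-- at each `OR`, merging nested `AND`s and nested `SAND`s, and dropping unary operators turns a term
-- into a term in which `AND` and `SAND` alternate. The set `sem t` of all terms so obtained, modulo
-- commutativity, is unchanged by the rules (`Rule.den_iff`), by commutativity (`CommAxiom.sem_eq`),
-- and hence by both in any context (`InContext.sem_eq`).
--
-- An alternating term denotes only itself (`IsAltNF.den_iff`), so a term of the grammar is, up to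
-- commutativity, the disjunction of its invariant, and two such terms with equal invariants are
-- equal modulo commutativity (`IsGrammarNF.commEq_of_sem_eq`). The normal forms are exactly the
-- terms of the grammar: those are irreducible (`IsGrammarNF.not_step`), and any deviation from the
-- grammar exhibits a redex (`Irreducible.isGrammarNF`). Termination gives each class a normal form,
-- and the invariant makes it unique; confluence follows.

theorem induction_on_args {P : SandTerm B → Prop} (basic : ∀ b, P (basic b))
    (or : ∀ ts, (∀ t ∈ ts, P t) → P (OR ts)) (and : ∀ ts, (∀ t ∈ ts, P t) → P (AND ts))
    (sand : ∀ ts, (∀ t ∈ ts, P t) → P (SAND ts)) (t : SandTerm B) : P t :=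
  SandTerm.rec (motive_1 := P) (motive_2 := fun ts => ∀ t ∈ ts, P t) basic or and sand
    (by simp) (fun _ _ h hs => by simpa using ⟨h, hs⟩) t

/-! ### The weight -/

/-- A polynomial interpretation in which every rewrite rule is strictly decreasing. -/
def weight : SandTerm B → ℕ
  | basic _ => 1
  | OR ts => 1 + (ts.map weight).sum
  | AND ts => 2 * (ts.map weight).prod
  | SAND ts => 2 * (ts.map weight).prod

theorem prod_map_weight_pos {ts : List (SandTerm B)} (h : ∀ t ∈ ts, 0 < weight t) :
    0 < (ts.map weight).prod :=
  List.prod_pos fun _ hn => by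
    obtain ⟨t, ht, rfl⟩ := List.mem_map.1 hn
    exact h t ht

theorem weight_pos (t : SandTerm B) : 0 < weight t := by
  induction t using induction_on_args with
  | basic b => simp [weight]
  | or ts ih => rw [weight]; omega
  | and ts ih => rw [weight]; have := prod_map_weight_pos ih; omega
  | sand ts ih => rw [weight]; have := prod_map_weight_pos ih; omega

theorem prod_weight_pos (ts : List (SandTerm B)) : 0 < (ts.map weight).prod :=
  prod_map_weight_pos fun t _ => weight_pos t

theorem sum_map_weight_of_mul (a : ℕ) (Y : List (SandTerm B))
    (f : SandTerm B → SandTerm B)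
    (hf : ∀ y, weight (f y) = a * weight y) :
    ((Y.map f).map weight).sum = a * (Y.map weight).sum := by
  rw [List.map_map, ← List.sum_map_mul_left]
  congr 1
  exact List.map_congr_left fun y _ => hf y

theorem Rule.weight_lt {s t : SandTerm B} (h : Rule s t) : weight t < weight s := by
  cases h with
  | E3 X Y _ => simp [weight]
  | E4 X Y _ =>
    have hX := prod_weight_pos X
    have hY := prod_weight_pos Y
    simp only [weight, List.map_append, List.prod_append, List.map_cons, List.map_nil,
      List.prod_cons, List.prod_nil]
    nlinarith [Nat.mul_pos hX hY]
  | E4' X Y Z _ =>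
    have hX := prod_weight_pos X
    have hY := prod_weight_pos Y
    have hZ := prod_weight_pos Z
    simp only [weight, List.map_append, List.prod_append, List.map_cons, List.map_nil,
      List.prod_cons, List.prod_nil]
    nlinarith [Nat.mul_pos (Nat.mul_pos hX hY) hZ]
  | E5 => simp [weight]
  | E6 => have := weight_pos t; simp [weight]; omega
  | E6' => have := weight_pos t; simp [weight]; omega
  | E10 X Y _ =>
    have hX := prod_weight_pos X
    -- With `a = 2 * (X.map weight).prod` and `S` the weight sum of `Y`, the two sides weigh `a * (1
    -- + S)` and `1 + a * S`. The factor 2 in the weight of `AND` forces `a > 1`.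
    rw [weight, sum_map_weight_of_mul (2 * (X.map weight).prod)]
    · simp only [weight, List.map_append, List.prod_append, List.map_cons, List.map_nil,
        List.prod_cons, List.prod_nil]
      nlinarith
    · intro y
      simp [weight, mul_assoc]
  | E10' X Y Z _ =>
    have hX := prod_weight_pos X
    have hZ := prod_weight_pos Z
    rw [weight, sum_map_weight_of_mul (2 * ((X.map weight).prod * (Z.map weight).prod))]
    · simp only [weight, List.map_append, List.prod_append, List.map_cons, List.map_nil,
        List.prod_cons, List.prod_nil]
      nlinarith [Nat.mul_pos hX hZ]
    · intro y
      simp only [weight, List.map_append, List.prod_append, List.map_cons, List.map_nil,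
        List.prod_cons, List.prod_nil]
      ring
  | E11 A X => have := weight_pos A; simp [weight]; omega

theorem CommAxiom.weight_eq {s t : SandTerm B} (h : CommAxiom s t) : weight s = weight t := by
  cases h with
  | E1 h => simp [weight, (h.map weight).sum_eq]
  | E2 h => simp [weight, (h.map weight).prod_eq]

theorem InContext.weight_eq {s t : SandTerm B} (h : InContext CommAxiom s t) :
    weight s = weight t := by
  induction h with
  | root h => exact h.weight_eq
  | or X Z _ ih => simp [weight, ih]
  | and X Z _ ih => simp [weight, ih]
  | sand X Z _ ih => simp [weight, ih]

theorem prod_weight_lt (X Z : List (SandTerm B)) {s t : SandTerm B} (h : weight t < weight s) :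
    ((X ++ t :: Z).map weight).prod < ((X ++ s :: Z).map weight).prod := by
  simp only [List.map_append, List.map_cons, List.prod_append, List.prod_cons]
  exact Nat.mul_lt_mul_of_pos_left
    (Nat.mul_lt_mul_of_pos_right h (prod_weight_pos Z)) (prod_weight_pos X)

theorem Step.weight_lt {s t : SandTerm B} (h : Step s t) : weight t < weight s := by
  induction h with
  | root h => exact h.weight_lt
  | or X Z _ ih => simp [weight, ih]
  | and X Z _ ih => simp only [weight]; have := prod_weight_lt X Z ih; omega
  | sand X Z _ ih => simp only [weight]; have := prod_weight_lt X Z ih; omega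

theorem CommEq.weight_eq {s t : SandTerm B} (h : CommEq s t) : weight s = weight t := by
  induction h with
  | rel _ _ h => exact h.weight_eq
  | refl => rfl
  | symm _ _ _ ih => exact ih.symm
  | trans _ _ _ _ _ ih ih' => exact ih.trans ih'

/-! ### Equality modulo commutativity -/

theorem CommEq.refl (t : SandTerm B) : CommEq t t := Relation.EqvGen.refl t

theorem CommEq.symm {s t : SandTerm B} (h : CommEq s t) : CommEq t s :=
  Relation.EqvGen.symm _ _ h

theorem CommEq.trans {s t u : SandTerm B} (h : CommEq s t) (h' : CommEq t u) : CommEq s u :=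
  Relation.EqvGen.trans _ _ _ h h'

theorem CommAxiom.symm {s t : SandTerm B} (h : CommAxiom s t) : CommAxiom t s := by
  cases h with
  | E1 h => exact .E1 h.symm
  | E2 h => exact .E2 h.symm

theorem InContext.symm {s t : SandTerm B} (h : InContext CommAxiom s t) :
    InContext CommAxiom t s := by
  induction h with
  | root h => exact .root h.symm
  | or X Z _ ih => exact .or X Z ih
  | and X Z _ ih => exact .and X Z ih
  | sand X Z _ ih => exact .sand X Z ih

/-- A predicate preserved by single commutativity steps is invariant under `CommEq`. -/
theorem CommEq.iff_of_imp {P : SandTerm B → Prop}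
    (hP : ∀ {s t}, InContext CommAxiom s t → P s → P t) {s t : SandTerm B} (h : CommEq s t) :
    P s ↔ P t := by
  induction h with
  | rel _ _ h => exact ⟨hP h, hP h.symm⟩
  | refl => rfl
  | symm _ _ _ ih => exact ih.symm
  | trans _ _ _ _ _ ih ih' => exact ih.trans ih'

theorem CommEq.lift {f : SandTerm B → SandTerm B}
    (hf : ∀ {s t}, InContext CommAxiom s t → InContext CommAxiom (f s) (f t))
    {s t : SandTerm B} (h : CommEq s t) : CommEq (f s) (f t) := by
  induction h with
  | rel _ _ h => exact .rel _ _ (hf h)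
  | refl => exact .refl _
  | symm _ _ _ ih => exact ih.symm
  | trans _ _ _ _ _ ih ih' => exact ih.trans ih'

theorem CommEq.or (X Z : List (SandTerm B)) {s t : SandTerm B} (h : CommEq s t) :
    CommEq (OR (X ++ s :: Z)) (OR (X ++ t :: Z)) :=
  h.lift fun h => .or X Z h

theorem CommEq.and (X Z : List (SandTerm B)) {s t : SandTerm B} (h : CommEq s t) :
    CommEq (AND (X ++ s :: Z)) (AND (X ++ t :: Z)) :=
  h.lift fun h => .and X Z h

theorem CommEq.sand (X Z : List (SandTerm B)) {s t : SandTerm B} (h : CommEq s t) :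
    CommEq (SAND (X ++ s :: Z)) (SAND (X ++ t :: Z)) :=
  h.lift fun h => .sand X Z h

theorem CommEq.or_perm {l l' : List (SandTerm B)} (h : l.Perm l') : CommEq (OR l) (OR l') :=
  .rel _ _ (.root (.E1 h))

theorem CommEq.and_perm {l l' : List (SandTerm B)} (h : l.Perm l') : CommEq (AND l) (AND l') :=
  .rel _ _ (.root (.E2 h))

/-- An operator compatible with `CommEq` in each argument. -/
def Congruent (op : List (SandTerm B) → SandTerm B) : Prop :=
  ∀ X Z {s t}, CommEq s t → CommEq (op (X ++ s :: Z)) (op (X ++ t :: Z))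

theorem Congruent.forall₂ {op : List (SandTerm B) → SandTerm B} (hop : Congruent op)
    {l l' : List (SandTerm B)} (h : List.Forall₂ CommEq l l') : CommEq (op l) (op l') := by
  -- The prefix `X` holds the arguments already exchanged.
  suffices ∀ X, CommEq (op (X ++ l)) (op (X ++ l')) from this []
  induction h with
  | nil => exact fun _ => .refl _
  | @cons a b l l' h _ ih =>
    intro X
    have := ih (X ++ [b])
    simp only [List.append_assoc, List.singleton_append] at this
    exact (hop X l h).trans this

/-- The class of a term modulo commutativity. -/
def commClass (t : SandTerm B) : Quotient (Relation.EqvGen.setoid (InContext (@CommAxiom B))) :=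
  Quotient.mk _ t

theorem commClass_eq {s t : SandTerm B} : commClass s = commClass t ↔ CommEq s t :=
  Quotient.eq

theorem forall₂_of_map_commClass_eq {l l' : List (SandTerm B)}
    (h : l.map commClass = l'.map commClass) : List.Forall₂ CommEq l l' := by
  have := List.forall₂_eq_eq_eq.symm ▸ h
  rw [List.forall₂_map_left_iff, List.forall₂_map_right_iff] at this
  exact this.imp fun _ _ h => commClass_eq.1 h

/-- A permutation of the classes lifts to the terms: `l'` can be rearranged into a list `m` whose
classes agree with those of `l` position by position. Congruence then leads from `l` to `m`, and
`hperm` from `m` to `l'`. -/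
theorem Congruent.perm {op : List (SandTerm B) → SandTerm B} (hop : Congruent op)
    (hperm : ∀ {l l'}, l.Perm l' → CommEq (op l) (op l')) {l l' : List (SandTerm B)}
    (h : (l.map commClass).Perm (l'.map commClass)) : CommEq (op l) (op l') := by
  have h1 : List.Forall₂ (fun a b => b = commClass a) l' (l'.map commClass) := by
    rw [List.forall₂_map_right_iff]
    exact List.forall₂_same.2 fun _ _ => rfl
  obtain ⟨m, hm, hml⟩ := List.perm_comp_forall₂ h (r := fun b a => b = commClass a) h1.flip
  have hm' : l.map commClass = m.map commClass := by
    rw [← List.forall₂_eq_eq_eq, List.forall₂_map_right_iff]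
    exact hm
  exact (hop.forall₂ (forall₂_of_map_commClass_eq hm')).trans (hperm hml)

/-- The operator `op` applied to a list, with `op [t]` simplified to `t`. -/
def collapse (op : List (SandTerm B) → SandTerm B) : List (SandTerm B) → SandTerm B
  | [t] => t
  | ts => op ts

theorem collapse_of_length {op : List (SandTerm B) → SandTerm B} {l : List (SandTerm B)}
    (h : l.length ≠ 1) : collapse op l = op l := by
  match l, h with
  | [], _ => rfl
  | _ :: _ :: _, _ => rfl

theorem collapse_congr_of_length {op : List (SandTerm B) → SandTerm B} {l l' : List (SandTerm B)}
    (hlen : l.length = l'.length) (h1 : ∀ a b, l = [a] → l' = [b] → CommEq a b)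
    (h : CommEq (op l) (op l')) : CommEq (collapse op l) (collapse op l') := by
  by_cases h' : l.length = 1
  · obtain ⟨a, rfl⟩ := List.length_eq_one_iff.1 h'
    obtain ⟨b, rfl⟩ := List.length_eq_one_iff.1 (hlen ▸ h')
    exact h1 a b rfl rfl
  · rwa [collapse_of_length h', collapse_of_length (hlen ▸ h')]

theorem Congruent.collapse_perm {op : List (SandTerm B) → SandTerm B} (hop : Congruent op)
    (hperm : ∀ {l l'}, l.Perm l' → CommEq (op l) (op l')) {l l' : List (SandTerm B)}
    (h : (l.map commClass).Perm (l'.map commClass)) :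
    CommEq (collapse op l) (collapse op l') :=
  collapse_congr_of_length (by simpa using h.length_eq)
    (by rintro a b rfl rfl; simpa [commClass_eq] using h) (hop.perm hperm h)

theorem Congruent.collapse {op : List (SandTerm B) → SandTerm B} (hop : Congruent op)
    {l l' : List (SandTerm B)} (h : l.map commClass = l'.map commClass) :
    CommEq (collapse op l) (collapse op l') :=
  collapse_congr_of_length (by simpa using congrArg List.length h)
    (by rintro a b rfl rfl; simpa [commClass_eq] using h)
    (hop.forall₂ (forall₂_of_map_commClass_eq h))

/-! ### Arguments of the outermost operator -/

/-- The parallel components of a term. -/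
def andArgs : SandTerm B → List (SandTerm B)
  | AND ts => ts
  | t => [t]

/-- The sequential components of a term. -/
def sandArgs : SandTerm B → List (SandTerm B)
  | SAND ts => ts
  | t => [t]

theorem InContext.commClass_eq {s t : SandTerm B} (h : InContext CommAxiom s t) :
    commClass s = commClass t :=
  SandTerm.commClass_eq.2 (.rel _ _ h)

/-- Commutativity never changes the outermost operator. It can permute the arguments of an outer
`AND`, or act inside a single component; a term without outer `AND` is its own only component. -/
theorem CommEq.andArgs_perm {s t : SandTerm B} (h : CommEq s t) :
    ((andArgs s).map commClass).Perm ((andArgs t).map commClass) := by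
  induction h with
  | rel s t h =>
    cases h with
    | root h =>
      cases h with
      | E1 h => simp [andArgs, commClass_eq, CommEq.or_perm h]
      | E2 h => exact h.map _
    | or X Z h => simpa [andArgs] using (h.or X Z).commClass_eq
    | and X Z h => simp [andArgs, h.commClass_eq]
    | sand X Z h => simpa [andArgs] using (h.sand X Z).commClass_eq
  | refl => exact .refl _
  | symm _ _ _ ih => exact ih.symm
  | trans _ _ _ _ _ ih ih' => exact ih.trans ih'

theorem CommEq.sandArgs_eq {s t : SandTerm B} (h : CommEq s t) :
    (sandArgs s).map commClass = (sandArgs t).map commClass := by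
  induction h with
  | rel s t h =>
    cases h with
    | root h =>
      cases h with
      | E1 h => simp [sandArgs, commClass_eq, CommEq.or_perm h]
      | E2 h => simp [sandArgs, commClass_eq, CommEq.and_perm h]
    | or X Z h => simpa [sandArgs] using (h.or X Z).commClass_eq
    | and X Z h => simpa [sandArgs] using (h.and X Z).commClass_eq
    | sand X Z h => simp [sandArgs, h.commClass_eq]
  | refl => rfl
  | symm _ _ _ ih => exact ih.symm
  | trans _ _ _ _ _ ih ih' => exact ih.trans ih'

theorem IsSandNF.andArgs_eq {t : SandTerm B} (h : IsSandNF t) : andArgs t = [t] := by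
  cases h <;> rfl

theorem IsAndNF.sandArgs_eq {t : SandTerm B} (h : IsAndNF t) : sandArgs t = [t] := by
  cases h <;> rfl

theorem flatMap_eq_self {α : Type*} {f : α → List α} {l : List α} (h : ∀ a ∈ l, f a = [a]) :
    l.flatMap f = l := by
  rw [List.flatMap_congr h]
  simp

/-- This is why merging one level of `AND` suffices: no component of an alternating term is itself
an `AND`. -/
theorem IsAltNF.of_mem_andArgs {t u : SandTerm B} (h : IsAltNF t) (hu : u ∈ andArgs t) :
    IsSandNF u := by
  rcases h with h | h
  · cases h with
    | basic b => rw [List.mem_singleton.1 hu]; exact .basic b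
    | and ts _ h => exact h u hu
  · rw [h.andArgs_eq] at hu
    rwa [List.mem_singleton.1 hu]

theorem IsAltNF.of_mem_sandArgs {t u : SandTerm B} (h : IsAltNF t) (hu : u ∈ sandArgs t) :
    IsAndNF u := by
  rcases h with h | h
  · rw [h.sandArgs_eq] at hu
    rwa [List.mem_singleton.1 hu]
  · cases h with
    | basic b => rw [List.mem_singleton.1 hu]; exact .basic b
    | sand ts _ h => exact h u hu

theorem andArgs_ne_nil {t : SandTerm B} (h : IsAltNF t) : andArgs t ≠ [] := by
  rcases h with h | h
  · cases h with
    | basic b => simp [andArgs]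
    | and ts h _ => rintro rfl; simp at h
  · simp [h.andArgs_eq]

theorem sandArgs_ne_nil {t : SandTerm B} (h : IsAltNF t) : sandArgs t ≠ [] := by
  rcases h with h | h
  · simp [h.sandArgs_eq]
  · cases h with
    | basic b => simp [sandArgs]
    | sand ts h _ => rintro rfl; simp at h

theorem collapse_andArgs {t : SandTerm B} (h : IsAltNF t) : collapse AND (andArgs t) = t := by
  rcases h with h | h
  · cases h with
    | basic b => rfl
    | and ts h _ => exact collapse_of_length (show ts.length ≠ 1 by omega)
  · rw [h.andArgs_eq]; rfl

theorem collapse_sandArgs {t : SandTerm B} (h : IsAltNF t) : collapse SAND (sandArgs t) = t := by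
  rcases h with h | h
  · rw [h.sandArgs_eq]; rfl
  · cases h with
    | basic b => rfl
    | sand ts h _ => exact collapse_of_length (show ts.length ≠ 1 by omega)

theorem andArgs_collapse {l : List (SandTerm B)} (h : ∀ t ∈ l, IsSandNF t) :
    andArgs (collapse AND l) = l := by
  match l, h with
  | [], _ => rfl
  | [t], h => exact (h t (by simp)).andArgs_eq
  | _ :: _ :: _, _ => rfl

theorem sandArgs_collapse {l : List (SandTerm B)} (h : ∀ t ∈ l, IsAndNF t) :
    sandArgs (collapse SAND l) = l := by
  match l, h with
  | [], _ => rfl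
  | [t], h => exact (h t (by simp)).sandArgs_eq
  | _ :: _ :: _, _ => rfl

theorem isAltNF_collapse_and {l : List (SandTerm B)} (hl : l ≠ []) (h : ∀ t ∈ l, IsSandNF t) :
    IsAltNF (collapse AND l) := by
  match l, hl, h with
  | [t], _, h => exact .sand (h t (by simp))
  | _ :: _ :: _, _, h => exact .and (.and _ (by simp) h)

theorem isAltNF_collapse_sand {l : List (SandTerm B)} (hl : l ≠ []) (h : ∀ t ∈ l, IsAndNF t) :
    IsAltNF (collapse SAND l) := by
  match l, hl, h with
  | [t], _, h => exact .and (h t (by simp))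
  | _ :: _ :: _, _, h => exact .sand (.sand _ (by simp) h)

/-! ### The set of alternating terms denoted by a term -/

/-- `Den t u` says that the alternating term `u` is one of the alternatives denoted by `t`. -/
inductive Den : SandTerm B → SandTerm B → Prop
  | basic (b : B) : Den (basic b) (basic b)
  | or {ts : List (SandTerm B)} {t u : SandTerm B} : t ∈ ts → Den t u → Den (OR ts) u
  | and {ts us : List (SandTerm B)} : ts ≠ [] → List.Forall₂ Den ts us →
      Den (AND ts) (collapse AND (us.flatMap andArgs))
  | sand {ts us : List (SandTerm B)} : ts ≠ [] → List.Forall₂ Den ts us →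
      Den (SAND ts) (collapse SAND (us.flatMap sandArgs))

theorem den_basic {b : B} {u : SandTerm B} : Den (basic b) u ↔ u = basic b :=
  ⟨fun h => by cases h; rfl, fun h => h ▸ .basic b⟩

theorem den_or {ts : List (SandTerm B)} {u : SandTerm B} :
    Den (OR ts) u ↔ ∃ t ∈ ts, Den t u :=
  ⟨fun h => by cases h with | or ht h => exact ⟨_, ht, h⟩, fun ⟨_, ht, h⟩ => .or ht h⟩

theorem den_and {ts : List (SandTerm B)} {v : SandTerm B} :
    Den (AND ts) v ↔
      ts ≠ [] ∧ ∃ us, List.Forall₂ Den ts us ∧ v = collapse AND (us.flatMap andArgs) :=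
  ⟨fun h => by cases h with | and hts h => exact ⟨hts, _, h, rfl⟩,
    fun ⟨hts, _, h, hv⟩ => hv ▸ .and hts h⟩

theorem den_sand {ts : List (SandTerm B)} {v : SandTerm B} :
    Den (SAND ts) v ↔
      ts ≠ [] ∧ ∃ us, List.Forall₂ Den ts us ∧ v = collapse SAND (us.flatMap sandArgs) :=
  ⟨fun h => by cases h with | sand hts h => exact ⟨hts, _, h, rfl⟩,
    fun ⟨hts, _, h, hv⟩ => hv ▸ .sand hts h⟩

theorem forall₂_append_left_iff {α β : Type*} {R : α → β → Prop} {l₁ l₂ : List α} {m : List β} :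
    List.Forall₂ R (l₁ ++ l₂) m ↔
      ∃ m₁ m₂, List.Forall₂ R l₁ m₁ ∧ List.Forall₂ R l₂ m₂ ∧ m = m₁ ++ m₂ := by
  constructor
  · intro h
    exact ⟨_, _, (List.forall₂_take_append _ _ _ h.flip).flip,
      (List.forall₂_drop_append _ _ _ h.flip).flip, (List.take_append_drop _ _).symm⟩
  · rintro ⟨m₁, m₂, h₁, h₂, rfl⟩
    exact List.rel_append h₁ h₂

theorem den_and_append_cons {X Z : List (SandTerm B)} {s v : SandTerm B} :
    Den (AND (X ++ s :: Z)) v ↔ ∃ xs u zs, List.Forall₂ Den X xs ∧ Den s u ∧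
      List.Forall₂ Den Z zs ∧
      v = collapse AND (xs.flatMap andArgs ++ (andArgs u ++ zs.flatMap andArgs)) := by
  simp only [den_and, forall₂_append_left_iff, List.forall₂_cons_left_iff]
  constructor
  · rintro ⟨-, _, ⟨xs, _, hX, ⟨u, zs, hs, hZ, rfl⟩, rfl⟩, rfl⟩
    exact ⟨xs, u, zs, hX, hs, hZ, by simp⟩
  · rintro ⟨xs, u, zs, hX, hs, hZ, rfl⟩
    exact ⟨by simp, _, ⟨xs, _, hX, ⟨u, zs, hs, hZ, rfl⟩, rfl⟩, by simp⟩

theorem den_sand_append_cons {X Z : List (SandTerm B)} {s v : SandTerm B} :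
    Den (SAND (X ++ s :: Z)) v ↔ ∃ xs u zs, List.Forall₂ Den X xs ∧ Den s u ∧
      List.Forall₂ Den Z zs ∧
      v = collapse SAND (xs.flatMap sandArgs ++ (sandArgs u ++ zs.flatMap sandArgs)) := by
  simp only [den_sand, forall₂_append_left_iff, List.forall₂_cons_left_iff]
  constructor
  · rintro ⟨-, _, ⟨xs, _, hX, ⟨u, zs, hs, hZ, rfl⟩, rfl⟩, rfl⟩
    exact ⟨xs, u, zs, hX, hs, hZ, by simp⟩
  · rintro ⟨xs, u, zs, hX, hs, hZ, rfl⟩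
    exact ⟨by simp, _, ⟨xs, _, hX, ⟨u, zs, hs, hZ, rfl⟩, rfl⟩, by simp⟩

theorem forall_mem_right_of_forall₂ {α β : Type*} {R : α → β → Prop} {Q : β → Prop}
    {l : List α} {m : List β} (h : List.Forall₂ R l m) (hQ : ∀ a ∈ l, ∀ b, R a b → Q b) :
    ∀ b ∈ m, Q b := by
  induction h with
  | nil => simp
  | cons hab _ ih =>
    simp only [List.mem_cons, forall_eq_or_imp] at hQ ⊢
    exact ⟨hQ.1 _ hab, ih hQ.2⟩

theorem flatMap_ne_nil_of_forall₂ {α β γ : Type*} {R : α → β → Prop} {f : β → List γ}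
    {l : List α} {m : List β} (h : List.Forall₂ R l m) (hl : l ≠ []) (hf : ∀ b ∈ m, f b ≠ []) :
    m.flatMap f ≠ [] := by
  cases h with
  | nil => exact absurd rfl hl
  | cons _ _ => simp [hf]

/-- The merged components have the right shape by `IsAltNF.of_mem_andArgs` and its sequential twin.
The condition `ts ≠ []` in `Den` keeps out `AND []` and `SAND []`, so no assumption `IsTree t` is
needed. -/
theorem Den.isAltNF {t u : SandTerm B} (h : Den t u) : IsAltNF u := by
  induction t using induction_on_args generalizing u with
  | basic b => rw [den_basic.1 h]; exact .and (.basic b)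
  | or ts ih =>
    obtain ⟨t, ht, h⟩ := den_or.1 h
    exact ih t ht h
  | and ts ih =>
    obtain ⟨hts, us, h₂, rfl⟩ := den_and.1 h
    have hus := forall_mem_right_of_forall₂ h₂ fun t ht _ => ih t ht
    refine isAltNF_collapse_and
      (flatMap_ne_nil_of_forall₂ h₂ hts fun u hu => andArgs_ne_nil (hus u hu)) fun t ht => ?_
    obtain ⟨u, hu, ht⟩ := List.mem_flatMap.1 ht
    exact (hus u hu).of_mem_andArgs ht
  | sand ts ih =>
    obtain ⟨hts, us, h₂, rfl⟩ := den_sand.1 h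
    have hus := forall_mem_right_of_forall₂ h₂ fun t ht _ => ih t ht
    refine isAltNF_collapse_sand
      (flatMap_ne_nil_of_forall₂ h₂ hts fun u hu => sandArgs_ne_nil (hus u hu)) fun t ht => ?_
    obtain ⟨u, hu, ht⟩ := List.mem_flatMap.1 ht
    exact (hus u hu).of_mem_sandArgs ht

theorem andArgs_collapse_flatMap {Y ys : List (SandTerm B)} (h : List.Forall₂ Den Y ys) :
    andArgs (collapse AND (ys.flatMap andArgs)) = ys.flatMap andArgs := by
  refine andArgs_collapse fun t ht => ?_
  obtain ⟨u, hu, ht⟩ := List.mem_flatMap.1 ht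
  exact (forall_mem_right_of_forall₂ h (fun _ _ _ h => h.isAltNF) u hu).of_mem_andArgs ht

theorem sandArgs_collapse_flatMap {Y ys : List (SandTerm B)} (h : List.Forall₂ Den Y ys) :
    sandArgs (collapse SAND (ys.flatMap sandArgs)) = ys.flatMap sandArgs := by
  refine sandArgs_collapse fun t ht => ?_
  obtain ⟨u, hu, ht⟩ := List.mem_flatMap.1 ht
  exact (forall_mem_right_of_forall₂ h (fun _ _ _ h => h.isAltNF) u hu).of_mem_sandArgs ht

/-- Taking components undoes `collapse`, so merging in two stages equals merging at once. `Y` must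
be nonempty, since `AND []` denotes nothing and would annihilate the left side. -/
theorem den_and_flatten {X Y Z : List (SandTerm B)} (hY : Y ≠ []) {v : SandTerm B} :
    Den (AND (X ++ AND Y :: Z)) v ↔ Den (AND (X ++ (Y ++ Z))) v := by
  rw [den_and_append_cons, den_and]
  simp only [forall₂_append_left_iff]
  constructor
  · rintro ⟨xs, u, zs, hX, hu, hZ, rfl⟩
    obtain ⟨-, ys, hys, rfl⟩ := den_and.1 hu
    exact ⟨by simp [hY], _, ⟨xs, _, hX, ⟨ys, zs, hys, hZ, rfl⟩, rfl⟩, by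
      simp [andArgs_collapse_flatMap hys]⟩
  · rintro ⟨-, _, ⟨xs, _, hX, ⟨ys, zs, hys, hZ, rfl⟩, rfl⟩, rfl⟩
    exact ⟨xs, _, zs, hX, .and hY hys, hZ, by simp [andArgs_collapse_flatMap hys]⟩

theorem den_sand_flatten {X Y Z : List (SandTerm B)} (hY : Y ≠ []) {v : SandTerm B} :
    Den (SAND (X ++ SAND Y :: Z)) v ↔ Den (SAND (X ++ (Y ++ Z))) v := by
  rw [den_sand_append_cons, den_sand]
  simp only [forall₂_append_left_iff]
  constructor
  · rintro ⟨xs, u, zs, hX, hu, hZ, rfl⟩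
    obtain ⟨-, ys, hys, rfl⟩ := den_sand.1 hu
    exact ⟨by simp [hY], _, ⟨xs, _, hX, ⟨ys, zs, hys, hZ, rfl⟩, rfl⟩, by
      simp [sandArgs_collapse_flatMap hys]⟩
  · rintro ⟨-, _, ⟨xs, _, hX, ⟨ys, zs, hys, hZ, rfl⟩, rfl⟩, rfl⟩
    exact ⟨xs, _, zs, hX, .sand hY hys, hZ, by simp [sandArgs_collapse_flatMap hys]⟩

theorem den_and_singleton {t v : SandTerm B} : Den (AND [t]) v ↔ Den t v := by
  rw [← List.nil_append [t], den_and_append_cons]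
  simp only [List.forall₂_nil_left_iff]
  constructor
  · rintro ⟨_, u, _, rfl, hu, rfl, rfl⟩
    simpa [collapse_andArgs hu.isAltNF] using hu
  · exact fun h => ⟨_, v, _, rfl, h, rfl, by simp [collapse_andArgs h.isAltNF]⟩

theorem den_sand_singleton {t v : SandTerm B} : Den (SAND [t]) v ↔ Den t v := by
  rw [← List.nil_append [t], den_sand_append_cons]
  simp only [List.forall₂_nil_left_iff]
  constructor
  · rintro ⟨_, u, _, rfl, hu, rfl, rfl⟩
    simpa [collapse_sandArgs hu.isAltNF] using hu
  · exact fun h => ⟨_, v, _, rfl, h, rfl, by simp [collapse_sandArgs h.isAltNF]⟩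

/-- Both sides choose one `y` in `Y` and one alternative for every other argument; only the position
of the existential quantifier differs. -/
theorem den_and_distrib {X Y Z : List (SandTerm B)} {v : SandTerm B} :
    Den (AND (X ++ OR Y :: Z)) v ↔ Den (OR (Y.map fun y => AND (X ++ y :: Z))) v := by
  simp only [den_or, List.mem_map, exists_exists_and_eq_and, den_and_append_cons]
  constructor
  · rintro ⟨xs, u, zs, hX, ⟨y, hy, hu⟩, hZ, hv⟩
    exact ⟨y, hy, xs, u, zs, hX, hu, hZ, hv⟩
  · rintro ⟨y, hy, xs, u, zs, hX, hu, hZ, hv⟩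
    exact ⟨xs, u, zs, hX, ⟨y, hy, hu⟩, hZ, hv⟩

theorem den_sand_distrib {X Y Z : List (SandTerm B)} {v : SandTerm B} :
    Den (SAND (X ++ OR Y :: Z)) v ↔ Den (OR (Y.map fun y => SAND (X ++ y :: Z))) v := by
  simp only [den_or, List.mem_map, exists_exists_and_eq_and, den_sand_append_cons]
  constructor
  · rintro ⟨xs, u, zs, hX, ⟨y, hy, hu⟩, hZ, hv⟩
    exact ⟨y, hy, xs, u, zs, hX, hu, hZ, hv⟩
  · rintro ⟨y, hy, xs, u, zs, hX, hu, hZ, hv⟩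
    exact ⟨xs, u, zs, hX, ⟨y, hy, hu⟩, hZ, hv⟩

/-- The rewrite rules preserve the denoted alternatives, even without commutativity. -/
theorem Rule.den_iff {s t : SandTerm B} (h : Rule s t) (v : SandTerm B) :
    Den s v ↔ Den t v := by
  cases h with
  | E3 X Y _ => simp [den_or, or_and_right, exists_or]
  | E4 X Y hY => simpa using den_and_flatten (X := X) (Z := []) hY
  | E4' X Y Z hY => simpa using den_sand_flatten hY
  | E5 => simp [den_or]
  | E6 => exact den_and_singleton
  | E6' => exact den_sand_singleton
  | E10 X Y _ => exact den_and_distrib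
  | E10' X Y Z _ => simpa using den_sand_distrib
  | E11 A X => simp [den_or]

/-- The alternatives denoted by a term, modulo commutativity. -/
def sem (t : SandTerm B) : Set (Quotient (Relation.EqvGen.setoid (InContext (@CommAxiom B)))) :=
  commClass '' {u | Den t u}

theorem sem_subset_iff {s t : SandTerm B} :
    sem s ⊆ sem t ↔ ∀ u, Den s u → ∃ u', Den t u' ∧ CommEq u u' := by
  simp only [sem, Set.image_subset_iff]
  refine forall₂_congr fun u _ => ?_
  simp only [Set.mem_preimage, Set.mem_image, Set.mem_ofPred_eq, commClass_eq]
  exact exists_congr fun u' => and_congr_right fun _ => ⟨CommEq.symm, CommEq.symm⟩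

theorem Rule.sem_eq {s t : SandTerm B} (h : Rule s t) : sem s = sem t := by
  simp only [sem, h.den_iff]

theorem CommAxiom.sem_subset {s t : SandTerm B} (h : CommAxiom s t) : sem s ⊆ sem t := by
  refine sem_subset_iff.2 fun u hu => ?_
  cases h with
  | E1 h =>
    simp only [den_or] at hu ⊢
    exact ⟨u, by simpa only [h.mem_iff] using hu, .refl u⟩
  | E2 h =>
    obtain ⟨hY, us, hus, rfl⟩ := den_and.1 hu
    -- The chosen alternatives are permuted along with the arguments.
    obtain ⟨us', hus', hp⟩ := List.perm_comp_forall₂ h.symm hus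
    refine ⟨_, .and ?_ hus', ?_⟩
    · rintro rfl
      exact hY h.eq_nil
    · exact Congruent.collapse_perm CommEq.and CommEq.and_perm
        ((hp.symm.flatMap_right andArgs).map commClass)

theorem CommAxiom.sem_eq {s t : SandTerm B} (h : CommAxiom s t) : sem s = sem t :=
  h.sem_subset.antisymm h.symm.sem_subset

theorem sem_or_subset (X Z : List (SandTerm B)) {s t : SandTerm B} (h : sem s ⊆ sem t) :
    sem (OR (X ++ s :: Z)) ⊆ sem (OR (X ++ t :: Z)) := by
  rw [sem_subset_iff] at h ⊢
  intro u hu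
  obtain ⟨r, hr, hru⟩ := den_or.1 hu
  simp only [List.mem_append, List.mem_cons] at hr
  rcases hr with hr | rfl | hr
  · exact ⟨u, .or (by simp [hr]) hru, .refl u⟩
  · obtain ⟨u', hu', huu⟩ := h u hru
    exact ⟨u', .or (by simp) hu', huu⟩
  · exact ⟨u, .or (by simp [hr]) hru, .refl u⟩

/-- Replacing `u` by an equivalent `u'` permutes its parallel components up to classes, which
commutativity of `AND` absorbs. For `SAND` the components must, and do, agree in order. -/
theorem sem_and_subset (X Z : List (SandTerm B)) {s t : SandTerm B} (h : sem s ⊆ sem t) :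
    sem (AND (X ++ s :: Z)) ⊆ sem (AND (X ++ t :: Z)) := by
  rw [sem_subset_iff] at h ⊢
  intro v hv
  obtain ⟨xs, u, zs, hX, hu, hZ, rfl⟩ := den_and_append_cons.1 hv
  obtain ⟨u', hu', huu⟩ := h u hu
  refine ⟨_, den_and_append_cons.2 ⟨xs, u', zs, hX, hu', hZ, rfl⟩, ?_⟩
  refine Congruent.collapse_perm CommEq.and CommEq.and_perm ?_
  simp only [List.map_append]
  exact (huu.andArgs_perm.append_right _).append_left _

theorem sem_sand_subset (X Z : List (SandTerm B)) {s t : SandTerm B} (h : sem s ⊆ sem t) :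
    sem (SAND (X ++ s :: Z)) ⊆ sem (SAND (X ++ t :: Z)) := by
  rw [sem_subset_iff] at h ⊢
  intro v hv
  obtain ⟨xs, u, zs, hX, hu, hZ, rfl⟩ := den_sand_append_cons.1 hv
  obtain ⟨u', hu', huu⟩ := h u hu
  refine ⟨_, den_sand_append_cons.2 ⟨xs, u', zs, hX, hu', hZ, rfl⟩, ?_⟩
  refine Congruent.collapse CommEq.sand ?_
  simp only [List.map_append, huu.sandArgs_eq]

/-- The relation is arbitrary so that rewrite rules and commutativity axioms are both covered. -/
theorem InContext.sem_eq {r : SandTerm B → SandTerm B → Prop}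
    (hr : ∀ {s t}, r s t → sem s = sem t) {s t : SandTerm B} (h : InContext r s t) :
    sem s = sem t := by
  induction h with
  | root h => exact hr h
  | or X Z _ ih => exact (sem_or_subset X Z ih.le).antisymm (sem_or_subset X Z ih.ge)
  | and X Z _ ih => exact (sem_and_subset X Z ih.le).antisymm (sem_and_subset X Z ih.ge)
  | sand X Z _ ih => exact (sem_sand_subset X Z ih.le).antisymm (sem_sand_subset X Z ih.ge)

theorem Step.sem_eq {s t : SandTerm B} (h : Step s t) : sem s = sem t :=
  InContext.sem_eq Rule.sem_eq h

theorem CommEq.sem_eq {s t : SandTerm B} (h : CommEq s t) : sem s = sem t := by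
  induction h with
  | rel _ _ h => exact h.sem_eq CommAxiom.sem_eq
  | refl => rfl
  | symm _ _ _ ih => exact ih.symm
  | trans _ _ _ _ _ ih ih' => exact ih.trans ih'

/-! ### Terms generated by the grammar are determined by their denotation -/

theorem isAltNF_and {ts : List (SandTerm B)} :
    IsAltNF (AND ts) ↔ 2 ≤ ts.length ∧ ∀ t ∈ ts, IsSandNF t :=
  ⟨fun h => by rcases h with ⟨⟨⟩⟩ | ⟨⟨⟩⟩; constructor <;> assumption,
    fun h => .and (.and _ h.1 h.2)⟩

theorem isAltNF_sand {ts : List (SandTerm B)} :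
    IsAltNF (SAND ts) ↔ 2 ≤ ts.length ∧ ∀ t ∈ ts, IsAndNF t :=
  ⟨fun h => by rcases h with ⟨⟨⟩⟩ | ⟨⟨⟩⟩; constructor <;> assumption,
    fun h => .sand (.sand _ h.1 h.2)⟩

theorem not_isAltNF_or {ts : List (SandTerm B)} : ¬ IsAltNF (OR ts) := by
  rintro (⟨⟨⟩⟩ | ⟨⟨⟩⟩)

theorem not_isSandNF_and {ts : List (SandTerm B)} : ¬ IsSandNF (AND ts) := by rintro ⟨⟩

theorem not_isAndNF_sand {ts : List (SandTerm B)} : ¬ IsAndNF (SAND ts) := by rintro ⟨⟩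

theorem isGrammarNF_or {ts : List (SandTerm B)} :
    IsGrammarNF (OR ts) ↔
      2 ≤ ts.length ∧ (∀ t ∈ ts, IsAltNF t) ∧ (ts.map commClass).Nodup := by
  rw [List.Nodup, List.pairwise_map]
  simp only [ne_eq, commClass_eq]
  constructor
  · intro h
    cases h with
    | single h => exact absurd h not_isAltNF_or
    | or _ h1 h2 h3 => exact ⟨h1, h2, h3⟩
  · exact fun ⟨h1, h2, h3⟩ => .or _ h1 h2 h3

theorem IsGrammarNF.isAltNF {t : SandTerm B} (h : IsGrammarNF t) (ht : ∀ ts, t ≠ OR ts) :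
    IsAltNF t := by
  cases h with
  | single h => exact h
  | or ts => exact absurd rfl (ht ts)

theorem forall₂_iff_eq {α : Type*} {R : α → α → Prop} {l m : List α}
    (h : ∀ a ∈ l, ∀ b, R a b ↔ b = a) : List.Forall₂ R l m ↔ m = l := by
  induction l generalizing m with
  | nil => simp
  | cons a l ih =>
    simp only [List.mem_cons, forall_eq_or_imp] at h
    simp [List.forall₂_cons_left_iff, h.1, ih h.2]

/-- There is no `OR` to choose from, no argument that merges into its parent, and no unary operator
to drop. -/
theorem IsAltNF.den_iff {t : SandTerm B} (h : IsAltNF t) {u : SandTerm B} :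
    Den t u ↔ u = t := by
  induction t using induction_on_args generalizing u with
  | basic b => exact den_basic
  | or ts => exact absurd h not_isAltNF_or
  | and ts ih =>
    obtain ⟨hlen, hts⟩ := isAltNF_and.1 h
    have hne : ts ≠ [] := by rintro rfl; simp at hlen
    simp only [den_and, forall₂_iff_eq fun t ht _ => ih t ht (.sand (hts t ht)), exists_eq_left,
      flatMap_eq_self fun t ht => (hts t ht).andArgs_eq, hne, ne_eq, not_false_eq_true, true_and]
    rw [collapse_of_length (by omega)]
  | sand ts ih =>
    obtain ⟨hlen, hts⟩ := isAltNF_sand.1 h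
    have hne : ts ≠ [] := by rintro rfl; simp at hlen
    simp only [den_sand, forall₂_iff_eq fun t ht _ => ih t ht (.and (hts t ht)), exists_eq_left,
      flatMap_eq_self fun t ht => (hts t ht).sandArgs_eq, hne, ne_eq, not_false_eq_true, true_and]
    rw [collapse_of_length (by omega)]

/-- Treats a single alternating term as a disjunction of length one, so that the two forms of the
grammar are compared uniformly. -/
theorem IsGrammarNF.exists_eq_collapse {t : SandTerm B} (h : IsGrammarNF t) :
    ∃ l : List (SandTerm B), t = collapse OR l ∧ (l.map commClass).Nodup ∧
      sem t = {c | c ∈ l.map commClass} := by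
  by_cases ht : ∃ ts, t = OR ts
  · obtain ⟨ts, rfl⟩ := ht
    obtain ⟨hlen, hts, hnd⟩ := isGrammarNF_or.1 h
    refine ⟨ts, (collapse_of_length (by omega)).symm, hnd, ?_⟩
    ext c
    simp only [sem, den_or, Set.mem_image, Set.mem_ofPred_eq, List.mem_map]
    constructor
    · rintro ⟨u, ⟨t, ht, hu⟩, rfl⟩
      exact ⟨t, ht, by rw [(hts t ht).den_iff.1 hu]⟩
    · rintro ⟨t, ht, rfl⟩
      exact ⟨t, ⟨t, ht, (hts t ht).den_iff.2 rfl⟩, rfl⟩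
  · have := h.isAltNF fun ts h => ht ⟨ts, h⟩
    refine ⟨[t], rfl, by simp, ?_⟩
    ext c
    simp [sem, this.den_iff, eq_comm]

theorem IsGrammarNF.commEq_of_sem_eq {s t : SandTerm B} (hs : IsGrammarNF s)
    (ht : IsGrammarNF t) (h : sem s = sem t) : CommEq s t := by
  obtain ⟨l, rfl, hl, hsl⟩ := hs.exists_eq_collapse
  obtain ⟨m, rfl, hm, htm⟩ := ht.exists_eq_collapse
  -- Duplicate-free lists of classes with the same members are permutations of each other.
  refine Congruent.collapse_perm CommEq.or CommEq.or_perm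
    ((List.perm_ext_iff_of_nodup hl hm).2 fun c => ?_)
  exact Set.ext_iff.1 (hsl.symm.trans (h.trans htm)) c

/-! ### Terms generated by the grammar are irreducible -/

theorem forall_mem_append_cons {P : SandTerm B → Prop} {X Z : List (SandTerm B)}
    {s t : SandTerm B} (h : ∀ a ∈ X ++ s :: Z, P a) (hst : P s → P t) :
    ∀ a ∈ X ++ t :: Z, P a := by
  simp only [List.mem_append, List.mem_cons] at h ⊢
  rintro a (ha | rfl | ha)
  · exact h a (.inl ha)
  · exact hst (h s (by simp))
  · exact h a (.inr (.inr ha))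

/-- Both claims are proved together because the arguments of one kind of term are of the other kind.
-/
theorem InContext.isAndNF_and_isSandNF {s t : SandTerm B} (h : InContext CommAxiom s t) :
    (IsAndNF s → IsAndNF t) ∧ (IsSandNF s → IsSandNF t) := by
  induction h with
  | root h =>
    cases h with
    | E1 h => exact ⟨fun h' => absurd (.and h') not_isAltNF_or,
        fun h' => absurd (.sand h') not_isAltNF_or⟩
    | E2 h =>
      refine ⟨fun h' => ?_, fun h' => absurd h' not_isSandNF_and⟩
      obtain ⟨h1, h2⟩ := isAltNF_and.1 (.and h')
      exact .and _ (h.length_eq ▸ h1) fun t ht => h2 t (h.mem_iff.2 ht)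
  | or X Z =>
    exact ⟨fun h' => absurd (.and h') not_isAltNF_or, fun h' => absurd (.sand h') not_isAltNF_or⟩
  | and X Z _ ih =>
    refine ⟨fun h' => ?_, fun h' => absurd h' not_isSandNF_and⟩
    obtain ⟨h1, h2⟩ := isAltNF_and.1 (.and h')
    exact .and _ (by simpa using h1) (forall_mem_append_cons h2 ih.2)
  | sand X Z _ ih =>
    refine ⟨fun h' => absurd h' not_isAndNF_sand, fun h' => ?_⟩
    obtain ⟨h1, h2⟩ := isAltNF_sand.1 (.sand h')
    exact .sand _ (by simpa using h1) (forall_mem_append_cons h2 ih.1)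

theorem InContext.isAltNF {s t : SandTerm B} (h : InContext CommAxiom s t) (hs : IsAltNF s) :
    IsAltNF t :=
  match hs with
  | .and hs => .and (h.isAndNF_and_isSandNF.1 hs)
  | .sand hs => .sand (h.isAndNF_and_isSandNF.2 hs)

theorem InContext.isGrammarNF {s t : SandTerm B} (h : InContext CommAxiom s t)
    (hs : IsGrammarNF s) : IsGrammarNF t := by
  have hs' := hs
  cases hs' with
  | single h' => exact .single (h.isAltNF h')
  | or ts =>
    obtain ⟨h1, h2, h3⟩ := isGrammarNF_or.1 hs
    cases h with
    | root h =>
      cases h with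
      | E1 h => exact isGrammarNF_or.2 ⟨h.length_eq ▸ h1, fun t ht => h2 t (h.mem_iff.2 ht),
          (h.map commClass).nodup_iff.1 h3⟩
    | or X Z h =>
      refine isGrammarNF_or.2 ⟨by simpa using h1, forall_mem_append_cons h2 h.isAltNF, ?_⟩
      simpa [h.commClass_eq] using h3

theorem CommEq.isGrammarNF_iff {s t : SandTerm B} (h : CommEq s t) :
    IsGrammarNF s ↔ IsGrammarNF t :=
  h.iff_of_imp InContext.isGrammarNF

theorem IsAltNF.not_step {s t : SandTerm B} (hs : IsAltNF s) : ¬ Step s t := by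
  intro h
  induction h with
  | root h =>
    cases h with
    | E3 => exact not_isAltNF_or hs
    | E4 X Y => exact not_isSandNF_and ((isAltNF_and.1 hs).2 (AND Y) (by simp))
    | E4' X Y Z => exact not_isAndNF_sand ((isAltNF_sand.1 hs).2 (SAND Y) (by simp))
    | E5 => exact not_isAltNF_or hs
    | E6 => simpa using (isAltNF_and.1 hs).1
    | E6' => simpa using (isAltNF_sand.1 hs).1
    | E10 X Y => exact not_isAltNF_or (.sand ((isAltNF_and.1 hs).2 (OR Y) (by simp)))
    | E10' X Y Z => exact not_isAltNF_or (.and ((isAltNF_sand.1 hs).2 (OR Y) (by simp)))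
    | E11 => exact not_isAltNF_or hs
  | or => exact not_isAltNF_or hs
  | and X Z _ ih => exact ih (.sand ((isAltNF_and.1 hs).2 _ (by simp)))
  | sand X Z _ ih => exact ih (.and ((isAltNF_sand.1 hs).2 _ (by simp)))

/-- Syntactic steps suffice here: the grammar is closed under commutativity, so the result applies
to every representative of a class. -/
theorem IsGrammarNF.not_step {s t : SandTerm B} (hs : IsGrammarNF s) : ¬ Step s t := by
  intro h
  have hs' := hs
  cases hs' with
  | single hs => exact hs.not_step h
  | or ts =>
    obtain ⟨h1, h2, h3⟩ := isGrammarNF_or.1 hs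
    cases h with
    | root h =>
      cases h with
      | E3 X Y => exact not_isAltNF_or (h2 (OR Y) (by simp))
      | E5 => simp at h1
      | E11 => simp at h3
    | or X Z h => exact (h2 _ (by simp)).not_step h

/-! ### Irreducible trees are generated by the grammar -/

theorem isTree_or {ts : List (SandTerm B)} : IsTree (OR ts) ↔ ts ≠ [] ∧ ∀ t ∈ ts, IsTree t :=
  ⟨fun h => by cases h; constructor <;> assumption, fun h => .or _ h.1 h.2⟩

theorem isTree_and {ts : List (SandTerm B)} : IsTree (AND ts) ↔ ts ≠ [] ∧ ∀ t ∈ ts, IsTree t :=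
  ⟨fun h => by cases h; constructor <;> assumption, fun h => .and _ h.1 h.2⟩

theorem isTree_sand {ts : List (SandTerm B)} :
    IsTree (SAND ts) ↔ ts ≠ [] ∧ ∀ t ∈ ts, IsTree t :=
  ⟨fun h => by cases h; constructor <;> assumption, fun h => .sand _ h.1 h.2⟩

theorem InContext.isTree {r : SandTerm B → SandTerm B → Prop}
    (hr : ∀ {s t}, r s t → IsTree s → IsTree t) {s t : SandTerm B} (h : InContext r s t)
    (hs : IsTree s) : IsTree t := by
  induction h with
  | root h => exact hr h hs
  | or X Z _ ih =>
    exact isTree_or.2 ⟨by simp, forall_mem_append_cons (isTree_or.1 hs).2 ih⟩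
  | and X Z _ ih =>
    exact isTree_and.2 ⟨by simp, forall_mem_append_cons (isTree_and.1 hs).2 ih⟩
  | sand X Z _ ih =>
    exact isTree_sand.2 ⟨by simp, forall_mem_append_cons (isTree_sand.1 hs).2 ih⟩

theorem CommAxiom.isTree {s t : SandTerm B} (h : CommAxiom s t) (hs : IsTree s) : IsTree t := by
  cases h with
  | E1 h =>
    obtain ⟨h1, h2⟩ := isTree_or.1 hs
    exact isTree_or.2 ⟨fun h' => h1 (h' ▸ h).eq_nil, fun t ht => h2 t (h.mem_iff.2 ht)⟩
  | E2 h =>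
    obtain ⟨h1, h2⟩ := isTree_and.1 hs
    exact isTree_and.2 ⟨fun h' => h1 (h' ▸ h).eq_nil, fun t ht => h2 t (h.mem_iff.2 ht)⟩

theorem CommEq.isTree_iff {s t : SandTerm B} (h : CommEq s t) : IsTree s ↔ IsTree t :=
  h.iff_of_imp (InContext.isTree CommAxiom.isTree)

theorem Rule.isTree {s t : SandTerm B} (h : Rule s t) (hs : IsTree s) : IsTree t := by
  cases h <;> simp_all [isTree_or, isTree_and, isTree_sand, or_imp, forall_and]

theorem Step.isTree {s t : SandTerm B} (h : Step s t) (hs : IsTree s) : IsTree t :=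
  InContext.isTree Rule.isTree h hs

/-- A term is irreducible if no term equal to it modulo commutativity can be rewritten. -/
def Irreducible (t : SandTerm B) : Prop :=
  ∀ s, CommEq s t → ∀ u, ¬ Step s u

/-- The rules for flattening `OR` and `AND` and for distributing `AND` act on the last argument;
commutativity brings any argument there. -/
theorem exists_perm_append_singleton {t : SandTerm B} {ts : List (SandTerm B)} (h : t ∈ ts) :
    ∃ X, (X ++ [t]).Perm ts := by
  obtain ⟨X, Z, rfl⟩ := List.append_of_mem h
  exact ⟨X ++ Z, by
    simpa using (List.perm_append_comm (l₁ := Z) (l₂ := [t])).append_left X⟩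

theorem Irreducible.of_mem_or {t : SandTerm B} {ts : List (SandTerm B)}
    (h : Irreducible (OR ts)) (ht : t ∈ ts) : Irreducible t := by
  obtain ⟨X, Z, rfl⟩ := List.append_of_mem ht
  exact fun s hs u hu => h _ (hs.or X Z) _ (.or X Z hu)

theorem Irreducible.of_mem_and {t : SandTerm B} {ts : List (SandTerm B)}
    (h : Irreducible (AND ts)) (ht : t ∈ ts) : Irreducible t := by
  obtain ⟨X, Z, rfl⟩ := List.append_of_mem ht
  exact fun s hs u hu => h _ (hs.and X Z) _ (.and X Z hu)

theorem Irreducible.of_mem_sand {t : SandTerm B} {ts : List (SandTerm B)}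
    (h : Irreducible (SAND ts)) (ht : t ∈ ts) : Irreducible t := by
  obtain ⟨X, Z, rfl⟩ := List.append_of_mem ht
  exact fun s hs u hu => h _ (hs.sand X Z) _ (.sand X Z hu)

theorem two_le_length {α : Type*} {l : List α} (h : l ≠ []) (h' : ∀ a, l ≠ [a]) :
    2 ≤ l.length := by
  match l, h, h' with
  | [a], _, h' => exact absurd rfl (h' a)
  | _ :: _ :: _, _, _ => simp

theorem IsAltNF.isSandNF {t : SandTerm B} (h : IsAltNF t) (ht : ∀ ts, t ≠ AND ts) :
    IsSandNF t := by
  rcases h with h | h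
  · cases h with
    | basic b => exact .basic b
    | and ts => exact absurd rfl (ht ts)
  · exact h

theorem IsAltNF.isAndNF {t : SandTerm B} (h : IsAltNF t) (ht : ∀ ts, t ≠ SAND ts) :
    IsAndNF t := by
  rcases h with h | h
  · exact h
  · cases h with
    | basic b => exact .basic b
    | sand ts => exact absurd rfl (ht ts)

theorem Irreducible.isGrammarNF {t : SandTerm B} (h : Irreducible t) (ht : IsTree t) :
    IsGrammarNF t := by
  induction t using induction_on_args with
  | basic b => exact .single (.and (.basic b))
  | or ts ih =>
    obtain ⟨hne, htree⟩ := isTree_or.1 ht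
    refine isGrammarNF_or.2 ⟨two_le_length hne ?_, fun t hmem => ?_, ?_⟩
    · rintro a rfl
      exact h _ (.refl _) _ (.root (.E5 a))
    · refine (ih t hmem (h.of_mem_or hmem) (htree t hmem)).isAltNF ?_
      rintro Y rfl
      obtain ⟨X, hX⟩ := exists_perm_append_singleton hmem
      exact h _ (.or_perm hX) _ (.root (.E3 X Y (isTree_or.1 (htree _ hmem)).1))
    · rw [List.Nodup, List.pairwise_map, List.pairwise_iff_forall_sublist]
      intro a b hab heq
      -- Two equivalent disjuncts `a` and `b` are moved to the front and `b` is replaced by `a`,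
      -- giving a representative to which `E11` applies literally.
      obtain ⟨l, hl⟩ := hab.exists_perm_append
      have hba : CommEq (OR (a :: a :: l)) (OR ts) :=
        (CommEq.or [a] l (commClass_eq.1 heq)).trans (.or_perm hl.symm)
      exact h _ hba _ (.root (.E11 a l))
  | and ts ih =>
    obtain ⟨hne, htree⟩ := isTree_and.1 ht
    refine .single (isAltNF_and.2 ⟨two_le_length hne ?_, fun t hmem => ?_⟩)
    · rintro a rfl
      exact h _ (.refl _) _ (.root (.E6 a))
    · obtain ⟨X, hX⟩ := exists_perm_append_singleton hmem
      refine ((ih t hmem (h.of_mem_and hmem) (htree t hmem)).isAltNF ?_).isSandNF ?_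
      · rintro Y rfl
        exact h _ (.and_perm hX) _ (.root (.E10 X Y (isTree_or.1 (htree _ hmem)).1))
      · rintro Y rfl
        exact h _ (.and_perm hX) _ (.root (.E4 X Y (isTree_and.1 (htree _ hmem)).1))
  | sand ts ih =>
    obtain ⟨hne, htree⟩ := isTree_sand.1 ht
    refine .single (isAltNF_sand.2 ⟨two_le_length hne ?_, fun t hmem => ?_⟩)
    · rintro a rfl
      exact h _ (.refl _) _ (.root (.E6' a))
    · obtain ⟨X, Z, hX⟩ := List.append_of_mem hmem
      have hX' : X ++ [t] ++ Z = ts := by simp [hX]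
      refine ((ih t hmem (h.of_mem_sand hmem) (htree t hmem)).isAltNF ?_).isAndNF ?_
      · rintro Y rfl
        exact h _ (hX' ▸ .refl _) _ (.root (.E10' X Y Z (isTree_or.1 (htree _ hmem)).1))
      · rintro Y rfl
        exact h _ (hX' ▸ .refl _) _ (.root (.E4' X Y Z (isTree_sand.1 (htree _ hmem)).1))

end SandTerm

/-! ### The rewrite relation on classes -/

theorem SandTree.cls_eq {B : Type u} {s t : SandTree B} :
    s.cls = t.cls ↔ s.val.CommEq t.val :=
  Quotient.eq

namespace SandTreeModComm

variable {B : Type u}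

/-- The weight of a class. -/
def weight (p : SandTreeModComm B) : ℕ :=
  Quotient.lift (fun t : SandTree B => t.val.weight)
    (fun _ _ h => SandTerm.CommEq.weight_eq h) p

/-- The alternatives denoted by a class. -/
def sem (p : SandTreeModComm B) :
    Set (Quotient (Relation.EqvGen.setoid (SandTerm.InContext (@SandTerm.CommAxiom B)))) :=
  Quotient.lift (fun t : SandTree B => t.val.sem) (fun _ _ h => SandTerm.CommEq.sem_eq h) p

theorem Rewrites.weight_lt {p q : SandTreeModComm B} (h : Rewrites p q) :
    weight q < weight p := by
  obtain ⟨s, t, rfl, rfl, h⟩ := h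
  exact h.weight_lt

theorem sem_eq_of_reduces {p q : SandTreeModComm B} (h : Relation.ReflTransGen Rewrites p q) :
    sem p = sem q := by
  induction h with
  | refl => rfl
  | tail _ h ih =>
    obtain ⟨s, t, rfl, rfl, h⟩ := h
    exact ih.trans h.sem_eq

theorem stronglyTerminating : StronglyTerminating (Rewrites (B := B)) := by
  rintro ⟨f, hf⟩
  have hle : ∀ n, weight (f n) + n ≤ weight (f 0) := by
    intro n
    induction n with
    | zero => exact le_rfl
    | succ n ih => have := (hf n).weight_lt; omega
  have := hle (weight (f 0) + 1)
  omega

theorem exists_normalForm (p : SandTreeModComm B) :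
    ∃ q, Relation.ReflTransGen Rewrites p q ∧ IsNormalForm Rewrites q := by
  induction hn : weight p using Nat.strong_induction_on generalizing p with
  | _ n ih =>
    by_cases hp : IsNormalForm Rewrites p
    · exact ⟨p, .refl, hp⟩
    · simp only [IsNormalForm, not_forall, not_not] at hp
      obtain ⟨q, hpq⟩ := hp
      obtain ⟨r, hqr, hr⟩ := ih _ (hn ▸ hpq.weight_lt) q rfl
      exact ⟨r, .head hpq hqr, hr⟩

theorem isNormalForm_cls_iff (t : SandTree B) :
    IsNormalForm Rewrites t.cls ↔ t.val.IsGrammarNF := by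
  constructor
  · intro h
    refine SandTerm.Irreducible.isGrammarNF (fun s hs u hu => ?_) t.2
    have htree := hs.isTree_iff.2 t.2
    exact h _ ⟨⟨s, htree⟩, ⟨u, hu.isTree htree⟩, SandTree.cls_eq.2 hs, rfl, hu⟩
  · rintro h _ ⟨s, u, hs, rfl, hu⟩
    exact ((SandTree.cls_eq.1 hs).isGrammarNF_iff.2 h).not_step hu

theorem eq_of_isNormalForm {p q : SandTreeModComm B} (hp : IsNormalForm Rewrites p)
    (hq : IsNormalForm Rewrites q) (h : sem p = sem q) : p = q := by
  obtain ⟨s, rfl⟩ : ∃ s : SandTree B, s.cls = p := Quotient.exists_rep p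
  obtain ⟨t, rfl⟩ : ∃ t : SandTree B, t.cls = q := Quotient.exists_rep q
  exact SandTree.cls_eq.2 (((isNormalForm_cls_iff s).1 hp).commEq_of_sem_eq
    ((isNormalForm_cls_iff t).1 hq) h)

/-- Normal forms reached from `b` and from `c` both carry the invariant of `a`, so they coincide. -/
theorem confluent : Confluent (Rewrites (B := B)) := by
  intro a b c hab hac
  obtain ⟨d, hbd, hd⟩ := exists_normalForm b
  obtain ⟨e, hce, he⟩ := exists_normalForm c
  obtain rfl := eq_of_isNormalForm hd he
    ((sem_eq_of_reduces (hab.trans hbd)).symm.trans (sem_eq_of_reduces (hac.trans hce)))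
  exact ⟨d, hbd, hce⟩

end SandTreeModComm

theorem theorem2 (B : Type u) :
    StronglyTerminating (SandTreeModComm.Rewrites (B := B)) ∧
    Confluent (SandTreeModComm.Rewrites (B := B)) ∧
    (∀ t : SandTree B,
      IsNormalForm (SandTreeModComm.Rewrites (B := B)) t.cls ↔ t.val.IsGrammarNF) ∧
    (∀ p : SandTreeModComm B, ∃! q : SandTreeModComm B,
      Relation.ReflTransGen SandTreeModComm.Rewrites p q ∧
        IsNormalForm (SandTreeModComm.Rewrites (B := B)) q) := by
  refine ⟨SandTreeModComm.stronglyTerminating, SandTreeModComm.confluent,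
    SandTreeModComm.isNormalForm_cls_iff, fun p => ?_⟩
  obtain ⟨q, hpq, hq⟩ := SandTreeModComm.exists_normalForm p
  refine ⟨q, ⟨hpq, hq⟩, fun r ⟨hpr, hr⟩ => SandTreeModComm.eq_of_isNormalForm hr hq ?_⟩
  exact (SandTreeModComm.sem_eq_of_reduces hpr).symm.trans (SandTreeModComm.sem_eq_of_reduces hpq)
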